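/- **Setting.** Let $X$ be a compact connected Hausdorff complex manifold of dimension $k$. A holomorphic correspondence $F$ on $X$ is a formal sum $\Gamma=\sum_{j=1}^N m_j\Gamma_j$ ($N\ge 1$) with positive integers $m_j$ and distinct irreducible complex analytic subvarieties $\Gamma_j\subset X\times X$ of dimension $k$, such that both coordinate projections $\pi_1,\pi_2$ map each $\Gamma_j$ onto $X$ and every point of $X$ has, counted with multiplicity, only finitely many images and preimages under $\Gamma$. Put $|\Gamma|=\bigcup_j\Gamma_j$ and, for $A\subset X$, $F^\dagger(A)=\pi_1(\pi_2^{-1}(A)\cap|\Gamma|)$. The topological degree $d$ of $F$ is the number of preimages of a generic point of $X$, the points of $\Gamma_j$ being counted $m_j$ times. In a sum $\sum'_{w\in F^\dagger(z)}$ the points $w$ are repeated according to multiplicity: $w$ counts $\sum_{j:(w,z)\in\Gamma_j} m_j\,\nu_j(w,z)$ times, where $\nu_j(w,z)$ is the local multiplicity of $\pi_2|_{\Gamma_j}$ at $(w,z)$. Let $\mu$ be a Borel probability measure on $X$ that is $F^*$ invariant, that is, $$\int_X \sideset{}{'}\sum_{w\in F^\dagger(z)}\varphi(w)\,d\mu(z)=d\int_X\varphi\,d\mu\qquad\text{for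 all } \varphi\in\mathcal C(X,\mathbb R).$$ A Borel set $B\subset X$ is almost invariant if there is a Borel set $B'\subset B$ with $\mu(B')=\mu(B)$ and $F^\dagger(B')\subset B$; $F$ is ergodic with respect to $\mu$ if $\mu(B)\in\{0,1\}$ for every almost invariant Borel set $B$. Let $(U_F\varphi)(z)=\frac1d\sum'_{w\in F^\dagger(z)}\varphi(w)$, $I_j^F(\varphi,\psi)=\int_X (U_F^{\,j}\varphi)\,\psi\,d\mu$ for $j\ge 0$, and $I(\varphi)=\int_X\varphi\,d\mu$. **Theorem.** The following are equivalent. 1. $F$ is ergodic with respect to $\mu$. 2. For all real-valued $\varphi,\psi\in L^2(\mu)$, $\displaystyle\lim_{n\to\infty}\frac1n\sum_{j=0}^{n-1}I_j^F(\varphi,\psi)=I(\varphi)I(\psi)$. 3. For all $\varphi\in\mathcal C(X,\mathbb R)$ and all real-valued $\psi\in L^1(\mu)$, $\displaystyle\lim_{n\to\infty}\frac1n\sum_{j=0}^{n-1}I_j^F(\varphi,\psi)=I(\varphi)I(\psi)$. -/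

import Mathlib

open MeasureTheory Filter Topology Set
open scoped Manifold ContDiff

/-! ### Complex analytic subsets of a complex manifold -/

/-- `A` is a complex analytic subset (subvariety) of the complex manifold `M`: every point of `M`
has an open neighbourhood in which `A` is the common zero set of finitely many holomorphic
functions. (Such a set is closed.) -/
def IsAnalyticSubset {E H M : Type*} [NormedAddCommGroup E] [NormedSpace ℂ E]
    [TopologicalSpace H] (I : ModelWithCorners ℂ E H) [TopologicalSpace M] [ChartedSpace H M]
    (A : Set M) : Prop :=
  ∀ p : M, ∃ U : Set M, IsOpen U ∧ p ∈ U ∧ ∃ (m : ℕ) (f : Fin m → M → ℂ),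
    (∀ i, MDifferentiableOn I 𝓘(ℂ, ℂ) (f i) U) ∧ A ∩ U = {x ∈ U | ∀ i, f i x = 0}

/-- An irreducible analytic subset: nonempty, and not the union of two proper analytic subsets. -/
def IsIrreducibleAnalyticSubset {E H M : Type*} [NormedAddCommGroup E] [NormedSpace ℂ E]
    [TopologicalSpace H] (I : ModelWithCorners ℂ E H) [TopologicalSpace M] [ChartedSpace H M]
    (A : Set M) : Prop :=
  IsAnalyticSubset I A ∧ A.Nonempty ∧
    ∀ B C : Set M, IsAnalyticSubset I B → IsAnalyticSubset I C → A = B ∪ C → A = B ∨ A = C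

/-- `p` is a regular point of `A` at which `A` has dimension `r`: near `p`, the set `A` is the zero
set of a holomorphic map to `ℂ^c` that is a submersion at `p`, where `r + c` is the dimension of the
ambient manifold. -/
def IsRegularPointOfDim {E H M : Type*} [NormedAddCommGroup E] [NormedSpace ℂ E]
    [TopologicalSpace H] (I : ModelWithCorners ℂ E H) [TopologicalSpace M] [ChartedSpace H M]
    (A : Set M) (r : ℕ) (p : M) : Prop :=
  p ∈ A ∧ ∃ c : ℕ, r + c = Module.finrank ℂ E ∧
    ∃ U : Set M, IsOpen U ∧ p ∈ U ∧ ∃ f : M → (Fin c → ℂ),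
      MDifferentiableOn I 𝓘(ℂ, Fin c → ℂ) f U ∧
      Function.Surjective (mfderiv I 𝓘(ℂ, Fin c → ℂ) f p) ∧
      A ∩ U = {x ∈ U | f x = 0}

/-- `A` has (pure) dimension `r`: the regular points at which it has dimension `r` are dense in `A`.
For irreducible `A` this is the same as `dim A = r`. -/
def HasPureDim {E H M : Type*} [NormedAddCommGroup E] [NormedSpace ℂ E]
    [TopologicalSpace H] (I : ModelWithCorners ℂ E H) [TopologicalSpace M] [ChartedSpace H M]
    (A : Set M) (r : ℕ) : Prop :=
  A ⊆ closure {p | IsRegularPointOfDim I A r p}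

/-! ### Multiplicities -/

/-- The multiplicity at `(w, z)` of the projection of `A ⊆ X × X` to the second factor: the largest
number of points that lie in `A` over points `z'` arbitrarily close to `z`, and whose first
coordinate lies in an arbitrarily small neighbourhood of `w`. (For a branched covering this is the
number of points near `(w, z)` over a generic point near `z`, that is, the local degree.) -/
noncomputable def fiberMultiplicity {X : Type*} [TopologicalSpace X] (A : Set (X × X)) (w z : X) :
    ℕ∞ :=
  ⨅ U ∈ 𝓝 w, limsup (fun z' => {w' ∈ U | (w', z') ∈ A}.encard) (𝓝 z)

/-! ### Holomorphic correspondences -/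

/-- A holomorphic correspondence `Γ = ∑ j, m j • Γ j` on a complex manifold `X` of dimension `k`. -/
structure HolomorphicCorrespondence (k : ℕ) (X : Type*) [TopologicalSpace X]
    [ChartedSpace (EuclideanSpace ℂ (Fin k)) X] where
  /-- The number of components. -/
  N : ℕ
  N_pos : 0 < N
  /-- The multiplicity of each component. -/
  m : Fin N → ℕ
  m_pos : ∀ j, 0 < m j
  /-- The components. -/
  Γ : Fin N → Set (X × X)
  Γ_injective : Function.Injective Γ
  irreducible : ∀ j, IsIrreducibleAnalyticSubset
    (𝓘(ℂ, EuclideanSpace ℂ (Fin k)).prod 𝓘(ℂ, EuclideanSpace ℂ (Fin k))) (Γ j)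
  dim_eq : ∀ j, HasPureDim
    (𝓘(ℂ, EuclideanSpace ℂ (Fin k)).prod 𝓘(ℂ, EuclideanSpace ℂ (Fin k))) (Γ j) k
  surjective_fst : ∀ j, Prod.fst '' Γ j = univ
  surjective_snd : ∀ j, Prod.snd '' Γ j = univ
  /-- Every point has finitely many images, ... -/
  finite_image : ∀ j z, {w | (z, w) ∈ Γ j}.Finite
  /-- ... also when they are repeated according to their multiplicities. -/
  image_multiplicity : ∀ j z w, (z, w) ∈ Γ j → fiberMultiplicity (Prod.swap ⁻¹' Γ j) w z ≠ ⊤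
  /-- Every point has finitely many preimages, ... -/
  finite_preimage : ∀ j z, {w | (w, z) ∈ Γ j}.Finite
  /-- ... also when they are repeated according to their multiplicities. -/
  preimage_multiplicity : ∀ j z w, (w, z) ∈ Γ j → fiberMultiplicity (Γ j) w z ≠ ⊤

namespace HolomorphicCorrespondence

/-- The underlying set `|Γ|`, the union of the components. -/
def support {k : ℕ} {X : Type*} [TopologicalSpace X] [ChartedSpace (EuclideanSpace ℂ (Fin k)) X]
    (F : HolomorphicCorrespondence k X) : Set (X × X) :=
  ⋃ j, F.Γ j

/-- The preimage `F† A = π₁ (π₂⁻¹ A ∩ |Γ|)` of a set. -/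
def preimage {k : ℕ} {X : Type*} [TopologicalSpace X] [ChartedSpace (EuclideanSpace ℂ (Fin k)) X]
    (F : HolomorphicCorrespondence k X) (A : Set X) : Set X :=
  Prod.fst '' (Prod.snd ⁻¹' A ∩ F.support)

/-- The number of preimages of `z`, the points of `Γ j` over `z` being counted `m j` times. -/
noncomputable def numPreimages {k : ℕ} {X : Type*} [TopologicalSpace X]
    [ChartedSpace (EuclideanSpace ℂ (Fin k)) X] (F : HolomorphicCorrespondence k X) (z : X) : ℕ :=
  ∑ j, F.m j * {w | (w, z) ∈ F.Γ j}.ncard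

/-- The topological degree: the number of preimages of a generic point, written as the largest `n`
such that all points of some dense open set have at least `n` preimages. -/
noncomputable def topologicalDegree {k : ℕ} {X : Type*} [TopologicalSpace X]
    [ChartedSpace (EuclideanSpace ℂ (Fin k)) X] (F : HolomorphicCorrespondence k X) : ℕ :=
  sSup {n | ∃ G : Set X, IsOpen G ∧ Dense G ∧ ∀ z ∈ G, n ≤ F.numPreimages z}

/-- If all points of a dense open set have exactly `n` preimages, then the topological degree is
`n`. -/
theorem topologicalDegree_eq {k : ℕ} {X : Type*} [TopologicalSpace X] [Nonempty X]
    [ChartedSpace (EuclideanSpace ℂ (Fin k)) X] (F : HolomorphicCorrespondence k X) {n : ℕ}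
    {G : Set X} (hG : IsOpen G) (hd : Dense G) (h : ∀ z ∈ G, F.numPreimages z = n) :
    F.topologicalDegree = n := by
  refine IsGreatest.csSup_eq ⟨⟨G, hG, hd, fun z hz => (h z hz).ge⟩, ?_⟩
  rintro l ⟨G', hG', hd', h'⟩
  obtain ⟨z, hz, hz'⟩ := (hd.inter_of_isOpen_left hd' hG).nonempty
  exact (h' z hz').trans (h z hz).le

/-- The sum `∑' φ(w)` over `w ∈ F†(z)`, the points being repeated according to multiplicity: a point
`w` counts, for each component `Γ j` through `(w, z)`, with the multiplicity `m j` of the component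
times the multiplicity at `(w, z)` of the projection of `Γ j` to the second factor. -/
noncomputable def preimageSum {k : ℕ} {X : Type*} [TopologicalSpace X]
    [ChartedSpace (EuclideanSpace ℂ (Fin k)) X] (F : HolomorphicCorrespondence k X)
    (φ : X → ℝ) (z : X) : ℝ :=
  ∑ j, (F.m j : ℝ) *
    ∑ w ∈ (F.finite_preimage j z).toFinset, ((fiberMultiplicity (F.Γ j) w z).toNat : ℝ) * φ w

/-- The pairing `⟨F^* μ, φ⟩`. -/
noncomputable def pullback {k : ℕ} {X : Type*} [TopologicalSpace X]
    [ChartedSpace (EuclideanSpace ℂ (Fin k)) X] [MeasurableSpace X]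
    (F : HolomorphicCorrespondence k X) (μ : Measure X) (φ : C(X, ℝ)) : ℝ :=
  ∫ z, F.preimageSum φ z ∂μ

/-- `μ` is `F^*` invariant: `F^* μ = d μ`, where `d` is the topological degree. -/
def IsInvariant {k : ℕ} {X : Type*} [TopologicalSpace X]
    [ChartedSpace (EuclideanSpace ℂ (Fin k)) X] [MeasurableSpace X]
    (F : HolomorphicCorrespondence k X) (μ : Measure X) : Prop :=
  ∀ φ : C(X, ℝ), F.pullback μ φ = (F.topologicalDegree : ℝ) * ∫ z, φ z ∂μ

/-- The Borel set `B` is almost invariant with respect to `F` and `μ`. -/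
def IsAlmostInvariant {k : ℕ} {X : Type*} [TopologicalSpace X]
    [ChartedSpace (EuclideanSpace ℂ (Fin k)) X] [MeasurableSpace X]
    (F : HolomorphicCorrespondence k X) (μ : Measure X) (B : Set X) : Prop :=
  MeasurableSet B ∧ ∃ B' : Set X, MeasurableSet B' ∧ B' ⊆ B ∧ μ B = μ B' ∧ F.preimage B' ⊆ B

/-- `F` is ergodic with respect to `μ`. -/
def IsErgodic {k : ℕ} {X : Type*} [TopologicalSpace X]
    [ChartedSpace (EuclideanSpace ℂ (Fin k)) X] [MeasurableSpace X]
    (F : HolomorphicCorrespondence k X) (μ : Measure X) : Prop :=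
  ∀ B : Set X, F.IsAlmostInvariant μ B → μ B = 0 ∨ μ B = 1

/-- The Koopman operator `U_F`, on functions. -/
noncomputable def koopman {k : ℕ} {X : Type*} [TopologicalSpace X]
    [ChartedSpace (EuclideanSpace ℂ (Fin k)) X] (F : HolomorphicCorrespondence k X)
    (φ : X → ℝ) : X → ℝ :=
  fun z => 1 / (F.topologicalDegree : ℝ) * F.preimageSum φ z

/-- The integral `I_n^F(φ, ψ) = ∫ (U_F^n φ) ψ dμ`. -/
noncomputable def correlation {k : ℕ} {X : Type*} [TopologicalSpace X]
    [ChartedSpace (EuclideanSpace ℂ (Fin k)) X] [MeasurableSpace X]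
    (F : HolomorphicCorrespondence k X) (μ : Measure X) (n : ℕ) (φ ψ : X → ℝ) : ℝ :=
  ∫ z, (F.koopman^[n] φ) z * ψ z ∂μ

end HolomorphicCorrespondence

/-! Let `p z` be the number of preimages of `z` with multiplicity. The components are closed and `X`
is compact, so fibres are upper semicontinuous and `p z` bounds the number of geometric preimages
(weighted by the `m j`) of all points near `z`. Genericity of the degree `d` then gives `p ≥ d`
everywhere. Invariance tested on the constant `1` gives `∫ p dμ = d`, so `p = d` almost everywhere
(`IsInvariant.ae_preimageCount_eq`). At such a point each preimage splits, over nearby generic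
points, into exactly as many points as its multiplicity; hence `preimageSum φ` is continuous on `{p
= d}` for continuous `φ` (`continuousOn_preimageSum`). The normalised fibres therefore form a Markov
kernel preserving `μ` (`IsInvariant.exists_kernel`). Almost everywhere `U_F` is its Markov operator,
and `B` is almost invariant when almost no point of `B` has a transition out of `B`.

What remains concerns invariant Markov kernels. The operator contracts `L²`, so by von Neumann's
theorem the Cesàro means converge to the projection onto the fixed functions, which ergodicity
forces to be constants (`Invariant.ae_eq_const_of_averaging_eq`). Bounded observables allow `L¹`
weights by approximation. Conversely the indicator `χ` of an almost invariant `B` is fixed.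
Approximating `χ` in `L¹` by continuous observables, on which the operator is also a contraction,
yields `μ(B) = μ(B)²`. -/

theorem IsAnalyticSubset.isClosed {E H M : Type*} [NormedAddCommGroup E] [NormedSpace ℂ E]
    [TopologicalSpace H] {I : ModelWithCorners ℂ E H} [TopologicalSpace M] [ChartedSpace H M]
    {A : Set M} (hA : IsAnalyticSubset I A) : IsClosed A := by
  rw [← isOpen_compl_iff, isOpen_iff_mem_nhds]
  intro p hp
  obtain ⟨U, hU, hpU, m, f, hf, hAU⟩ := hA p
  have hz : ∃ i, f i p ≠ 0 := by
    by_contra! h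
    exact hp (hAU.symm.subset (show p ∈ {x ∈ U | ∀ i, f i x = 0} from ⟨hpU, h⟩)).1
  obtain ⟨i, hi⟩ := hz
  have hc : ContinuousAt (f i) p := (hf i).continuousOn.continuousAt (hU.mem_nhds hpU)
  filter_upwards [hU.mem_nhds hpU, hc.eventually_ne hi] with x hxU hx hxA
  exact hx ((hAU.subset ⟨hxA, hxU⟩).2 i)

/-! ### Semicontinuity of fibres and local multiplicity. -/

section Fibers

variable {X : Type*} [TopologicalSpace X]

/-- The fibres of a closed relation over a compact space vary upper semicontinuously. -/
theorem eventually_fiber_subset [CompactSpace X] {A : Set (X × X)} (hA : IsClosed A) {O : Set X}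
    (hO : IsOpen O) {z : X} (hz : ∀ w, (w, z) ∈ A → w ∈ O) :
    ∀ᶠ z' in 𝓝 z, ∀ w, (w, z') ∈ A → w ∈ O := by
  have hK : IsClosed (Prod.snd '' (A ∩ Prod.fst ⁻¹' Oᶜ)) :=
    isClosedMap_snd_of_compactSpace _ (hA.inter (hO.isClosed_compl.preimage continuous_fst))
  have hzK : z ∉ Prod.snd '' (A ∩ Prod.fst ⁻¹' Oᶜ) := by
    rintro ⟨⟨w, z'⟩, ⟨h1, h2⟩, rfl⟩
    exact h2 (hz w h1)
  filter_upwards [hK.isOpen_compl.mem_nhds hzK] with z' hz' w hw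
  by_contra hwO
  exact hz' ⟨(w, z'), ⟨hw, hwO⟩, rfl⟩

/-- The limit superior is taken over full neighbourhoods of `z`, so `z` itself, with its preimage
`w`, is seen at every stage. -/
theorem one_le_fiberMultiplicity {A : Set (X × X)} {w z : X} (h : (w, z) ∈ A) :
    1 ≤ fiberMultiplicity A w z := by
  refine le_iInf₂ fun U hU => le_limsup_of_frequently_le' ?_
  refine Filter.Frequently.filter_mono ?_ (pure_le_nhds z)
  rw [frequently_pure, Set.one_le_encard_iff_nonempty]
  exact ⟨w, mem_of_mem_nhds hU, h⟩

/-- Values lie in `ℕ∞`, so being below the finite multiplicity plus one is being at most the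
multiplicity; infimum and limit superior are thus reached. -/
theorem exists_nhds_encard_le {A : Set (X × X)} {w z : X} (h : fiberMultiplicity A w z ≠ ⊤) :
    ∃ U ∈ 𝓝 w, ∀ᶠ z' in 𝓝 z, {w' ∈ U | (w', z') ∈ A}.encard ≤ fiberMultiplicity A w z := by
  have hlt : fiberMultiplicity A w z < fiberMultiplicity A w z + 1 :=
    (ENat.lt_add_one_iff h).2 le_rfl
  obtain ⟨U, hU, hlt'⟩ : ∃ U ∈ 𝓝 w, limsup (fun z' => {w' ∈ U | (w', z') ∈ A}.encard) (𝓝 z)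
      < fiberMultiplicity A w z + 1 := by
    have := hlt
    conv_lhs at this => unfold fiberMultiplicity
    simpa only [iInf_lt_iff, exists_prop] using this
  refine ⟨U, hU, (eventually_lt_of_limsup_lt hlt').mono fun z' hz' => ?_⟩
  exact (ENat.lt_add_one_iff h).1 hz'

end Fibers

/-! ### Counting preimages and the topological degree. -/

namespace HolomorphicCorrespondence

variable {k : ℕ} {X : Type*} [TopologicalSpace X] [ChartedSpace (EuclideanSpace ℂ (Fin k)) X]
  (F : HolomorphicCorrespondence k X)

theorem isClosed_component (j : Fin F.N) : IsClosed (F.Γ j) := (F.irreducible j).1.isClosed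

/-- The points of the fibre of the `j`-th component over `z`. -/
noncomputable def fiber (j : Fin F.N) (z : X) : Finset X := (F.finite_preimage j z).toFinset

/-- The multiplicity of `w` in the fibre of the `j`-th component over `z`. -/
noncomputable def mult (j : Fin F.N) (w z : X) : ℕ := (fiberMultiplicity (F.Γ j) w z).toNat

variable {F} in
@[simp]
theorem mem_fiber {j : Fin F.N} {z w : X} : w ∈ F.fiber j z ↔ (w, z) ∈ F.Γ j := by
  simp [fiber]

theorem preimageSum_eq (φ : X → ℝ) (z : X) : F.preimageSum φ z =
    ∑ j, (F.m j : ℝ) * ∑ w ∈ F.fiber j z, (F.mult j w z : ℝ) * φ w := rfl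

theorem numPreimages_eq (z : X) : F.numPreimages z = ∑ j, F.m j * (F.fiber j z).card := by
  refine Finset.sum_congr rfl fun j _ => ?_
  rw [Set.ncard_eq_toFinset_card _ (F.finite_preimage j z), fiber]

theorem one_le_mult {j : Fin F.N} {w z : X} (h : (w, z) ∈ F.Γ j) : 1 ≤ F.mult j w z := by
  have h1 := one_le_fiberMultiplicity h
  have := ENat.toNat_le_toNat h1 (F.preimage_multiplicity j z w h)
  simpa [mult] using this

/-- The number of preimages of `z`, counted with multiplicity. -/
noncomputable def preimageCount (z : X) : ℕ := ∑ j, F.m j * ∑ w ∈ F.fiber j z, F.mult j w z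

theorem preimageSum_one (z : X) : F.preimageSum (fun _ => 1) z = F.preimageCount z := by
  simp [preimageSum_eq, preimageCount]

open Classical in
/-- Disjoint neighbourhoods of the points of a fibre in which the number of points of neighbouring
fibres is bounded by the multiplicity. -/
theorem exists_separation [T2Space X] (j : Fin F.N) (z : X) : ∃ V : X → Set X,
    (∀ w ∈ F.fiber j z, w ∈ V w ∧ IsOpen (V w)) ∧
    ((F.fiber j z : Set X).PairwiseDisjoint V) ∧
    ∀ᶠ z' in 𝓝 z, ∀ w ∈ F.fiber j z,
      ((F.fiber j z').filter (· ∈ V w)).card ≤ F.mult j w z := by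
  obtain ⟨V, hV, hd⟩ := (F.fiber j z).finite_toSet.t2_separation
  have H : ∀ w : X, ∃ U ∈ 𝓝 w, w ∈ F.fiber j z → ∀ᶠ z' in 𝓝 z,
      {w' ∈ U | (w', z') ∈ F.Γ j}.encard ≤ fiberMultiplicity (F.Γ j) w z := by
    intro w
    by_cases hw : w ∈ F.fiber j z
    · obtain ⟨U, hU, h⟩ :=
        exists_nhds_encard_le (F.preimage_multiplicity j z w (mem_fiber.1 hw))
      exact ⟨U, hU, fun _ => h⟩
    · exact ⟨univ, univ_mem, fun h => absurd h hw⟩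
  choose U hU hUc using H
  refine ⟨fun w => V w ∩ interior (U w), fun w hw => ⟨⟨(hV w).1, mem_interior_iff_mem_nhds.2 (hU w)⟩,
    (hV w).2.inter isOpen_interior⟩, hd.mono fun w => inter_subset_left, ?_⟩
  rw [Filter.eventually_all_finset]
  intro w hw
  filter_upwards [hUc w hw] with z' hz'
  have hsub : (((F.fiber j z').filter (· ∈ V w ∩ interior (U w)) : Finset X) : Set X) ⊆
      {w' ∈ U w | (w', z') ∈ F.Γ j} := by
    intro x hx
    simp only [Finset.coe_filter, mem_fiber, mem_ofPred_eq] at hx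
    exact ⟨interior_subset hx.2.2, hx.1⟩
  have h1 := (Set.encard_le_encard hsub).trans hz'
  rw [Set.encard_coe_eq_coe_finsetCard] at h1
  have := ENat.toNat_le_toNat h1 (F.preimage_multiplicity j z w (mem_fiber.1 hw))
  simpa [mult] using this

open Classical in
theorem sum_fiber_eq {M : Type*} [AddCommMonoid M] {j : Fin F.N} {z z' : X} {V : X → Set X}
    (hd : (F.fiber j z : Set X).PairwiseDisjoint V)
    (hsub : ∀ w', (w', z') ∈ F.Γ j → w' ∈ ⋃ w ∈ F.fiber j z, V w) (φ : X → M) :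
    ∑ w' ∈ F.fiber j z', φ w' =
      ∑ w ∈ F.fiber j z, ∑ w' ∈ (F.fiber j z').filter (· ∈ V w), φ w' := by
  rw [← Finset.sum_biUnion]
  · refine Finset.sum_congr ?_ fun _ _ => rfl
    ext w'
    simp only [Finset.mem_biUnion, Finset.mem_filter, mem_fiber]
    refine ⟨fun h => ?_, fun ⟨_, _, h, _⟩ => h⟩
    have := hsub w' h
    simp only [mem_iUnion, mem_fiber, exists_prop] at this
    obtain ⟨w, hw, hw'⟩ := this
    exact ⟨w, hw, h, hw'⟩
  · intro a ha b hb hab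
    rw [Function.onFun, Finset.disjoint_left]
    intro x hx hx'
    exact Set.disjoint_left.1 (hd ha hb hab) (Finset.mem_filter.1 hx).2 (Finset.mem_filter.1 hx').2

variable [CompactSpace X]

theorem eventually_fiber_subset_iUnion (j : Fin F.N) (z : X) {V : X → Set X}
    (hV : ∀ w ∈ F.fiber j z, w ∈ V w ∧ IsOpen (V w)) :
    ∀ᶠ z' in 𝓝 z, ∀ w', (w', z') ∈ F.Γ j → w' ∈ ⋃ w ∈ F.fiber j z, V w := by
  refine eventually_fiber_subset (F.isClosed_component j)
    (isOpen_biUnion fun w hw => (hV w hw).2) fun w hw => ?_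
  exact mem_biUnion (mem_fiber.2 hw) (hV w (mem_fiber.2 hw)).1

open Classical in
/-- Over a point whose number of preimages with multiplicity is the topological degree, nearby
generic fibres split according to the multiplicities. -/
theorem eventually_card_filter_eq {G : Set X}
    (hG : ∀ z ∈ G, F.topologicalDegree ≤ F.numPreimages z) {z : X}
    (hz : F.preimageCount z = F.topologicalDegree) {V : Fin F.N → X → Set X}
    (hV : ∀ j, ∀ w ∈ F.fiber j z, w ∈ V j w ∧ IsOpen (V j w))
    (hd : ∀ j, (F.fiber j z : Set X).PairwiseDisjoint (V j))
    (hc : ∀ j, ∀ᶠ z' in 𝓝 z, ∀ w ∈ F.fiber j z,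
      ((F.fiber j z').filter (· ∈ V j w)).card ≤ F.mult j w z) :
    ∀ᶠ z' in 𝓝[G] z, ∀ j, ∀ w ∈ F.fiber j z,
      ((F.fiber j z').filter (· ∈ V j w)).card = F.mult j w z := by
  filter_upwards [self_mem_nhdsWithin,
    eventually_nhdsWithin_of_eventually_nhds (eventually_all.2 hc),
    eventually_nhdsWithin_of_eventually_nhds
      (eventually_all.2 fun j => F.eventually_fiber_subset_iUnion j z (hV j))] with z' hz' h1 h2
  have hcard : ∀ j, (F.fiber j z').card =
      ∑ w ∈ F.fiber j z, ((F.fiber j z').filter (· ∈ V j w)).card := by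
    intro j
    rw [Finset.card_eq_sum_ones, F.sum_fiber_eq (hd j) (h2 j)]
    simp
  have hle : ∀ j, (F.fiber j z').card ≤ ∑ w ∈ F.fiber j z, F.mult j w z := fun j =>
    (hcard j).trans_le (Finset.sum_le_sum (h1 j))
  have hle' : ∀ j ∈ Finset.univ, F.m j * (F.fiber j z').card ≤
      F.m j * ∑ w ∈ F.fiber j z, F.mult j w z := fun j _ => Nat.mul_le_mul_left _ (hle j)
  -- The two totals agree: semicontinuity gives one inequality, and genericity of `z'` together with
  -- `hz` the other. Equality of the sums then forces equality in each of the termwise bounds.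
  have heq : ∑ j, F.m j * (F.fiber j z').card =
      ∑ j, F.m j * ∑ w ∈ F.fiber j z, F.mult j w z := by
    refine le_antisymm (Finset.sum_le_sum hle') ?_
    have := hG z' hz'
    rwa [numPreimages_eq, ← hz, preimageCount] at this
  intro j
  have h3 := (Finset.sum_eq_sum_iff_of_le hle').1 heq j (Finset.mem_univ j)
  have h4 := Nat.eq_of_mul_eq_mul_left (F.m_pos j) h3
  rw [hcard j] at h4
  exact (Finset.sum_eq_sum_iff_of_le (h1 j)).1 h4

variable [T2Space X]

theorem eventually_card_fiber_le (j : Fin F.N) (z : X) :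
    ∀ᶠ z' in 𝓝 z, (F.fiber j z').card ≤ ∑ w ∈ F.fiber j z, F.mult j w z := by
  classical
  obtain ⟨V, hV, hd, hc⟩ := F.exists_separation j z
  filter_upwards [hc, F.eventually_fiber_subset_iUnion j z hV] with z' h1 h2
  rw [Finset.card_eq_sum_ones, F.sum_fiber_eq hd h2]
  simpa using Finset.sum_le_sum h1

theorem eventually_numPreimages_le (z : X) :
    ∀ᶠ z' in 𝓝 z, F.numPreimages z' ≤ F.preimageCount z := by
  filter_upwards [eventually_all.2 fun j => F.eventually_card_fiber_le j z] with z' h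
  rw [numPreimages_eq, preimageCount]
  exact Finset.sum_le_sum fun j _ => Nat.mul_le_mul_left _ (h j)

/-- Some point of the dense set lies so close to `z` that semicontinuity applies to it. -/
theorem le_preimageCount {n : ℕ} {G : Set X} (hG : Dense G) (h : ∀ z ∈ G, n ≤ F.numPreimages z)
    (z : X) : n ≤ F.preimageCount z := by
  have hne : (𝓝[G] z).NeBot := mem_closure_iff_nhdsWithin_neBot.1 (hG z)
  obtain ⟨z', h1, h2⟩ := ((eventually_nhdsWithin_of_eventually_nhds
    (F.eventually_numPreimages_le z)).and (self_mem_nhdsWithin : G ∈ 𝓝[G] z)).exists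
  exact (h z' h2).trans h1

theorem bddAbove_numPreimages [Nonempty X] :
    BddAbove {n | ∃ G : Set X, IsOpen G ∧ Dense G ∧ ∀ z ∈ G, n ≤ F.numPreimages z} :=
  ⟨F.preimageCount (Classical.arbitrary X), fun _ ⟨_, _, hd, h⟩ => F.le_preimageCount hd h _⟩

theorem exists_dense_topologicalDegree_le [Nonempty X] :
    ∃ G : Set X, Dense G ∧ ∀ z ∈ G, F.topologicalDegree ≤ F.numPreimages z := by
  obtain ⟨G, -, hd, h⟩ := Nat.sSup_mem
    (s := {n | ∃ G : Set X, IsOpen G ∧ Dense G ∧ ∀ z ∈ G, n ≤ F.numPreimages z})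
    ⟨0, univ, isOpen_univ, dense_univ, fun _ _ => Nat.zero_le _⟩ F.bddAbove_numPreimages
  exact ⟨G, hd, h⟩

theorem topologicalDegree_le_preimageCount [Nonempty X] (z : X) :
    F.topologicalDegree ≤ F.preimageCount z := by
  obtain ⟨G, hd, h⟩ := F.exists_dense_topologicalDegree_le
  exact F.le_preimageCount hd h z

theorem topologicalDegree_pos [Nonempty X] : 0 < F.topologicalDegree := by
  -- Every point has a preimage in the first component, so `1` is admissible with the whole space as
  -- the generic set.
  refine Nat.lt_of_succ_le (le_csSup F.bddAbove_numPreimages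
    ⟨univ, isOpen_univ, dense_univ, fun z _ => ?_⟩)
  rw [numPreimages_eq]
  let j : Fin F.N := ⟨0, F.N_pos⟩
  have hz : z ∈ Prod.snd '' F.Γ j := by rw [F.surjective_snd j]; trivial
  obtain ⟨⟨w, z'⟩, hw, rfl⟩ := hz
  have h1 : 0 < F.m j * (F.fiber j z').card :=
    Nat.mul_pos (F.m_pos j) (Finset.card_pos.2 ⟨w, mem_fiber.2 hw⟩)
  exact h1.trans_le (Finset.single_le_sum (f := fun j => F.m j * (F.fiber j z').card)
    (fun _ _ => Nat.zero_le _) (Finset.mem_univ j))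

/-- Over generic `z'` near `z` exactly `mult j w z` distinct points cluster at each `w`, so counting
them once each reproduces the multiplicity in the limit. -/
theorem tendsto_sum_fiber {G : Set X}
    (hG : ∀ z ∈ G, F.topologicalDegree ≤ F.numPreimages z) {z : X}
    (hz : F.preimageCount z = F.topologicalDegree) {φ : X → ℝ} (hφ : Continuous φ) :
    Tendsto (fun z' => ∑ j, (F.m j : ℝ) * ∑ w ∈ F.fiber j z', φ w) (𝓝[G] z)
      (𝓝 (F.preimageSum φ z)) := by
  classical
  choose V hV hd hc using fun j => F.exists_separation j z
  have hev := F.eventually_card_filter_eq hG hz hV hd hc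
  refine tendsto_finsetSum _ fun j _ => Tendsto.const_mul _ ?_
  have hkey : Tendsto (fun z' => ∑ w ∈ F.fiber j z,
      ∑ w' ∈ (F.fiber j z').filter (· ∈ V j w), φ w') (𝓝[G] z)
      (𝓝 (∑ w ∈ F.fiber j z, (F.mult j w z : ℝ) * φ w)) := by
    refine tendsto_finsetSum _ fun w hw => ?_
    rw [Metric.tendsto_nhds]
    intro ε hε
    set δ : ℝ := ε / (F.mult j w z + 1) with hδ
    have hδ0 : 0 < δ := by positivity
    -- Shrinking the neighbourhoods makes `φ` nearly constant on each; the points of the fibre over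
    -- `z'` in `V j w` must lie in the shrunken set of `w`, by disjointness.
    have hV' : ∀ x ∈ F.fiber j z, x ∈ V j x ∩ {y | dist (φ y) (φ x) < δ} ∧
        IsOpen (V j x ∩ {y | dist (φ y) (φ x) < δ}) := fun x hx =>
      ⟨⟨(hV j x hx).1, by simpa using hδ0⟩,
        (hV j x hx).2.inter (isOpen_lt (hφ.dist continuous_const) continuous_const)⟩
    filter_upwards [hev, eventually_nhdsWithin_of_eventually_nhds
      (F.eventually_fiber_subset_iUnion j z hV')] with z' h1 h2
    have h3 : ∀ w' ∈ (F.fiber j z').filter (· ∈ V j w), dist (φ w') (φ w) ≤ δ := by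
      intro w' hw'
      rw [Finset.mem_filter, mem_fiber] at hw'
      have := h2 w' hw'.1
      simp only [mem_iUnion, exists_prop] at this
      obtain ⟨x, hx, hx1, hx2⟩ := this
      have hxw : x = w := by
        by_contra hne
        exact Set.disjoint_left.1 (hd j hx hw hne) hx1 hw'.2
      subst hxw
      exact le_of_lt hx2
    have h4 : (F.mult j w z : ℝ) * φ w = ∑ _w' ∈ (F.fiber j z').filter (· ∈ V j w), φ w := by
      rw [Finset.sum_const, h1 j w hw, nsmul_eq_mul]
    rw [h4]
    calc _ ≤ ∑ w' ∈ (F.fiber j z').filter (· ∈ V j w), dist (φ w') (φ w) := dist_sum_sum_le _ _ _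
      _ ≤ ∑ _w' ∈ (F.fiber j z').filter (· ∈ V j w), δ := Finset.sum_le_sum h3
      _ = F.mult j w z * δ := by rw [Finset.sum_const, h1 j w hw, nsmul_eq_mul]
      _ < ε := by
        rw [hδ, mul_div_assoc', div_lt_iff₀ (by positivity)]
        nlinarith
  refine hkey.congr' ?_
  filter_upwards [eventually_nhdsWithin_of_eventually_nhds
    (F.eventually_fiber_subset_iUnion j z (hV j))] with z' h2
  exact (F.sum_fiber_eq (hd j) h2 φ).symm

/-- On this set the function is the extension by continuity of the unweighted fibre sum from a dense
set, and such an extension is continuous wherever the limits exist. -/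
theorem continuousOn_preimageSum [Nonempty X] {φ : X → ℝ} (hφ : Continuous φ) :
    ContinuousOn (F.preimageSum φ) {z | F.preimageCount z = F.topologicalDegree} := by
  obtain ⟨G, hd, hG⟩ := F.exists_dense_topologicalDegree_le
  refine (continuousOn_extendFrom (fun z _ => hd z)
    fun z hz => ⟨_, F.tendsto_sum_fiber hG hz hφ⟩).congr fun z hz => ?_
  exact (extendFrom_eq (hd z) (F.tendsto_sum_fiber hG hz hφ)).symm

end HolomorphicCorrespondence

/-! ### Cesàro means under uniform approximation. -/

section Cesaro

theorem abs_cesaro_sub_le {a b : ℕ → ℝ} {ε : ℝ} (hε : 0 ≤ ε) (h : ∀ j, |a j - b j| ≤ ε) (n : ℕ) :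
    |1 / (n : ℝ) * ∑ j ∈ Finset.range n, a j - 1 / (n : ℝ) * ∑ j ∈ Finset.range n, b j| ≤ ε := by
  rcases Nat.eq_zero_or_pos n with rfl | hn
  · simpa using hε
  have hn' : (0 : ℝ) < n := by exact_mod_cast hn
  rw [← mul_sub, ← Finset.sum_sub_distrib, abs_mul, abs_of_pos (by positivity)]
  have : |∑ j ∈ Finset.range n, (a j - b j)| ≤ n * ε :=
    (Finset.abs_sum_le_sum_abs _ _).trans
      ((Finset.sum_le_sum fun j _ => h j).trans (by simp))
  calc 1 / (n : ℝ) * |∑ j ∈ Finset.range n, (a j - b j)| ≤ 1 / (n : ℝ) * (n * ε) := by gcongr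
    _ = ε := by field_simp

/-- Convergence of Cesàro means passes to uniform limits. -/
theorem tendsto_cesaro_of_approx {a : ℕ → ℝ} {L : ℝ}
    (h : ∀ ε > 0, ∃ (b : ℕ → ℝ) (M : ℝ), (∀ j, |a j - b j| ≤ ε) ∧ |M - L| ≤ ε ∧
      Tendsto (fun n : ℕ => 1 / (n : ℝ) * ∑ j ∈ Finset.range n, b j) atTop (𝓝 M)) :
    Tendsto (fun n : ℕ => 1 / (n : ℝ) * ∑ j ∈ Finset.range n, a j) atTop (𝓝 L) := by
  rw [Metric.tendsto_nhds]
  intro ε hε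
  obtain ⟨b, M, h1, h2, h3⟩ := h (ε / 4) (by positivity)
  filter_upwards [Metric.tendsto_nhds.1 h3 (ε / 4) (by positivity)] with n hn
  have h4 := abs_cesaro_sub_le (by positivity) h1 n
  rw [Real.dist_eq] at hn ⊢
  rw [abs_le] at h2 h4
  rw [abs_lt] at hn ⊢
  constructor <;> linarith [h2.1, h2.2, h4.1, h4.2, hn.1, hn.2]

end Cesaro

/-! ### Inner products and norms in `L²`. -/

namespace MeasureTheory.MemLp

variable {X : Type*} [MeasurableSpace X] {μ : Measure X}

theorem inner_toLp {f g : X → ℝ} (hf : MemLp f 2 μ)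
    (hg : MemLp g 2 μ) : inner ℝ (hf.toLp f) (hg.toLp g) = ∫ z, f z * g z ∂μ := by
  rw [L2.inner_def]
  refine integral_congr_ae ?_
  filter_upwards [hf.coeFn_toLp, hg.coeFn_toLp] with z h1 h2
  simp [h1, h2, mul_comm]

theorem norm_toLp_sq {f : X → ℝ} (hf : MemLp f 2 μ) :
    ‖hf.toLp f‖ ^ 2 = ∫ z, f z ^ 2 ∂μ := by
  rw [← real_inner_self_eq_norm_sq, L2.inner_def]
  refine integral_congr_ae ?_
  filter_upwards [hf.coeFn_toLp] with z hz
  simp [hz]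

end MeasureTheory.MemLp

/-! ### Ergodic theory of Markov kernels with an invariant measure. -/

namespace ProbabilityTheory.Kernel

variable {X : Type*} [MeasurableSpace X]

/-- The Markov operator of a kernel, on functions. -/
noncomputable def averaging (κ : Kernel X X) (φ : X → ℝ) : X → ℝ := fun z => ∫ w, φ w ∂κ z

variable {κ : Kernel X X} {μ : Measure X}

theorem Invariant.ae_ae (hκ : κ.Invariant μ) {p : X → Prop} (h : ∀ᵐ x ∂μ, p x) :
    ∀ᵐ z ∂μ, ∀ᵐ w ∂κ z, p w :=
  Measure.ae_ae_of_ae_comp (by rwa [hκ.def])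

theorem Invariant.averaging_congr (hκ : κ.Invariant μ) {f g : X → ℝ} (h : f =ᵐ[μ] g) :
    κ.averaging f =ᵐ[μ] κ.averaging g :=
  (hκ.ae_ae h).mono fun _ hz => integral_congr_ae hz

theorem Invariant.ae_integrable (hκ : κ.Invariant μ) {f : X → ℝ} (hf : Integrable f μ) :
    ∀ᵐ z ∂μ, Integrable f (κ z) :=
  Measure.ae_integrable_of_integrable_comp (by rwa [hκ.def])

theorem Invariant.integrable_averaging (hκ : κ.Invariant μ) {f : X → ℝ} (hf : Integrable f μ) :
    Integrable (κ.averaging f) μ := by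
  have h : Integrable f ((κ ∘ₖ Kernel.const Unit μ) ()) := by
    rwa [← Measure.comp_eq_comp_const_apply, hκ.def]
  have h2 := h.integral_comp
  rwa [Kernel.const_apply] at h2

theorem Invariant.integral_averaging (hκ : κ.Invariant μ) {f : X → ℝ} (hf : Integrable f μ) :
    ∫ z, κ.averaging f z ∂μ = ∫ z, f z ∂μ := by
  have h : Integrable f ((κ ∘ₖ Kernel.const Unit μ) ()) := by
    rwa [← Measure.comp_eq_comp_const_apply, hκ.def]
  have := Kernel.integral_comp h
  rw [← Measure.comp_eq_comp_const_apply, hκ.def] at this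
  simpa [averaging] using this.symm

theorem Invariant.integrable_iterate (hκ : κ.Invariant μ) {f : X → ℝ} (hf : Integrable f μ)
    (n : ℕ) : Integrable (κ.averaging^[n] f) μ := by
  induction n with
  | zero => exact hf
  | succ n ih => rw [Function.iterate_succ_apply']; exact hκ.integrable_averaging ih

theorem Invariant.integral_abs_averaging_sub_le (hκ : κ.Invariant μ) {f g : X → ℝ}
    (hf : Integrable f μ) (hg : Integrable g μ) :
    ∫ z, |κ.averaging f z - κ.averaging g z| ∂μ ≤ ∫ z, |f z - g z| ∂μ := by
  rw [← hκ.integral_averaging (f := fun z => |f z - g z|) (hf.sub hg).abs]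
  refine integral_mono_ae ((hκ.integrable_averaging hf).sub (hκ.integrable_averaging hg)).abs
    (hκ.integrable_averaging (hf.sub hg).abs) ?_
  filter_upwards [hκ.ae_integrable hf, hκ.ae_integrable hg] with z h1 h2
  simp only [averaging]
  rw [← integral_sub h1 h2]
  exact abs_integral_le_integral_abs

theorem Invariant.integral_abs_iterate_sub_le (hκ : κ.Invariant μ) {f g : X → ℝ}
    (hf : Integrable f μ) (hg : Integrable g μ) (n : ℕ) :
    ∫ z, |κ.averaging^[n] f z - κ.averaging^[n] g z| ∂μ ≤ ∫ z, |f z - g z| ∂μ := by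
  induction n with
  | zero => exact le_rfl
  | succ n ih =>
    simp only [Function.iterate_succ_apply']
    exact (hκ.integral_abs_averaging_sub_le (hκ.integrable_iterate hf n)
      (hκ.integrable_iterate hg n)).trans ih

variable [IsMarkovKernel κ]

theorem abs_iterate_averaging_le {f : X → ℝ} {M : ℝ} (h : ∀ z, |f z| ≤ M) (n : ℕ) (z : X) :
    |κ.averaging^[n] f z| ≤ M := by
  induction n generalizing z with
  | zero => exact h z
  | succ n ih =>
    rw [Function.iterate_succ_apply']
    have := norm_integral_le_of_norm_le_const (μ := κ z) (f := κ.averaging^[n] f) (C := M)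
      (ae_of_all _ fun w => by simpa using ih w)
    simpa [averaging] using this

variable [IsProbabilityMeasure μ]

/-- Sets without transitions to the complement have a fixed indicator function. -/
theorem Invariant.averaging_indicator (hκ : κ.Invariant μ) {B : Set X} (hB : MeasurableSet B)
    (h : ∀ᵐ z ∂μ, z ∈ B → κ z Bᶜ = 0) :
    κ.averaging (B.indicator fun _ => 1) =ᵐ[μ] B.indicator fun _ => 1 := by
  have hint : Integrable (B.indicator fun _ => (1 : ℝ)) μ := (integrable_const 1).indicator hB
  -- Averaging can only increase the indicator, yet it preserves the integral; so nothing changes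
  -- almost everywhere.
  have hle : (B.indicator fun _ => (1 : ℝ)) ≤ᵐ[μ] κ.averaging (B.indicator fun _ => 1) := by
    filter_upwards [h] with z hz
    by_cases hzB : z ∈ B
    · have h1 : ∀ᵐ w ∂κ z, B.indicator (fun _ => (1 : ℝ)) w = 1 := by
        have : ∀ᵐ w ∂κ z, w ∈ B := hz hzB
        filter_upwards [this] with w hw
        simp [hw]
      simp [averaging, integral_congr_ae h1, hzB]
    · rw [indicator_of_notMem hzB]
      exact integral_nonneg fun w => indicator_nonneg (fun _ _ => zero_le_one) w
  exact ((integral_eq_iff_of_ae_le hint (hκ.integrable_averaging hint) hle).1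
    (hκ.integral_averaging hint).symm).symm

/-- The positive part of `f - c` is subinvariant by convexity, hence invariant since its integral is
preserved. Where it vanishes, so does its average, so `{f ≤ c}` has no transitions out. Ergodicity
puts `f` on one side of its mean `c`. -/
theorem Invariant.ae_eq_const_of_averaging_eq (hκ : κ.Invariant μ)
    (herg : ∀ B, MeasurableSet B → (∀ᵐ z ∂μ, z ∈ B → κ z Bᶜ = 0) → μ B = 0 ∨ μ B = 1)
    {f : X → ℝ} (hfm : Measurable f) (hf : Integrable f μ) (hfix : κ.averaging f =ᵐ[μ] f) :
    f =ᵐ[μ] fun _ => ∫ z, f z ∂μ := by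
  set c := ∫ z, f z ∂μ with hc
  set g : X → ℝ := fun z => max (f z - c) 0 with hgdef
  have hfc : Integrable (fun z => f z - c) μ := hf.sub (integrable_const c)
  have hg : Integrable g μ := hfc.pos_part
  have hle : g ≤ᵐ[μ] κ.averaging g := by
    filter_upwards [hfix, hκ.ae_integrable hf, hκ.ae_integrable hg] with z h1 h2 h3
    refine max_le ?_ (integral_nonneg fun w => le_max_right _ _)
    rw [← h1]
    have : κ.averaging f z - c = ∫ w, (f w - c) ∂κ z := by
      rw [integral_sub h2 (integrable_const c)]
      simp [averaging]
    rw [this]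
    exact integral_mono (h2.sub (integrable_const c)) h3 fun w => le_max_left _ _
  have heq := (integral_eq_iff_of_ae_le hg (hκ.integrable_averaging hg) hle).1
    (hκ.integral_averaging hg).symm
  have hB : MeasurableSet {z | f z ≤ c} := measurableSet_le hfm measurable_const
  have hBinv : ∀ᵐ z ∂μ, z ∈ {z | f z ≤ c} → κ z {z | f z ≤ c}ᶜ = 0 := by
    filter_upwards [heq, hκ.ae_integrable hg] with z h1 h2 hz
    have hgz : ∫ w, g w ∂κ z = 0 := by
      have : g z = 0 := max_eq_right (sub_nonpos.2 hz)
      rw [← this, h1]; rfl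
    have h3 : g =ᵐ[κ z] 0 :=
      (integral_eq_zero_iff_of_nonneg (fun w => le_max_right _ _) h2).1 hgz
    have : ∀ᵐ w ∂κ z, w ∈ {z | f z ≤ c} := by
      filter_upwards [h3] with w hw
      exact sub_nonpos.1 (max_eq_right_iff.1 hw)
    exact this
  rcases herg _ hB hBinv with h0 | h1
  · have hle' : (fun _ => c) ≤ᵐ[μ] f := by
      have : ∀ᵐ z ∂μ, ¬ f z ≤ c := by simpa [ae_iff] using h0
      filter_upwards [this] with z hz using (not_le.1 hz).le
    exact ((integral_eq_iff_of_ae_le (integrable_const c) hf hle').1 (by simp [hc])).symm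
  · have hle' : f ≤ᵐ[μ] fun _ => c := (prob_compl_eq_zero_iff hB).2 h1
    exact (integral_eq_iff_of_ae_le hf (integrable_const c) hle').1 (by simp [hc])

theorem Invariant.sq_averaging_le (hκ : κ.Invariant μ) {f : X → ℝ} (hf : MemLp f 2 μ) :
    ∀ᵐ z ∂μ, κ.averaging f z ^ 2 ≤ κ.averaging (fun w => f w ^ 2) z := by
  filter_upwards [hκ.ae_integrable (hf.integrable one_le_two),
    hκ.ae_integrable hf.integrable_sq] with z h1 h2
  exact ConvexOn.map_integral_le (Even.convexOn_pow even_two) (by fun_prop) isClosed_univ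
    (ae_of_all _ fun _ => mem_univ _) h1 h2

theorem Invariant.memLp_averaging (hκ : κ.Invariant μ) {f : X → ℝ} (hf : MemLp f 2 μ) :
    MemLp (κ.averaging f) 2 μ := by
  have hm := (hκ.integrable_averaging (hf.integrable one_le_two)).aestronglyMeasurable
  refine (memLp_two_iff_integrable_sq hm).2 ?_
  refine (hκ.integrable_averaging hf.integrable_sq).mono' (hm.pow 2) ?_
  filter_upwards [hκ.sq_averaging_le hf] with z hz
  simpa using hz

theorem Invariant.memLp_iterate (hκ : κ.Invariant μ) {f : X → ℝ} (hf : MemLp f 2 μ) (n : ℕ) :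
    MemLp (κ.averaging^[n] f) 2 μ := by
  induction n with
  | zero => exact hf
  | succ n ih => rw [Function.iterate_succ_apply']; exact hκ.memLp_averaging ih

/-- The Markov operator of an invariant kernel as a contraction of `L²`. -/
noncomputable def averagingL2 (hκ : κ.Invariant μ) : Lp ℝ 2 μ →L[ℝ] Lp ℝ 2 μ :=
  LinearMap.mkContinuous
    { toFun := fun f => (hκ.memLp_averaging (Lp.memLp f)).toLp _
      map_add' := fun f g => by
        rw [← MemLp.toLp_add]
        refine (MemLp.toLp_eq_toLp_iff _ _).2 ?_
        filter_upwards [hκ.averaging_congr (Lp.coeFn_add f g),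
          hκ.ae_integrable ((Lp.memLp f).integrable one_le_two),
          hκ.ae_integrable ((Lp.memLp g).integrable one_le_two)] with z h1 h2 h3
        rw [h1]
        exact integral_add h2 h3
      map_smul' := fun c f => by
        rw [RingHom.id_apply, ← MemLp.toLp_const_smul]
        refine (MemLp.toLp_eq_toLp_iff _ _).2 ?_
        filter_upwards [hκ.averaging_congr (Lp.coeFn_smul c f)] with z h1
        rw [h1]
        exact integral_const_mul c f } 1 fun f => by
    rw [one_mul]
    refine le_of_sq_le_sq ?_ (norm_nonneg _)
    have h := Lp.memLp f
    calc ‖(hκ.memLp_averaging h).toLp _‖ ^ 2 = ∫ z, κ.averaging f z ^ 2 ∂μ :=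
          (hκ.memLp_averaging h).norm_toLp_sq
      _ ≤ ∫ z, κ.averaging (fun w => f w ^ 2) z ∂μ :=
          integral_mono_ae (hκ.memLp_averaging h).integrable_sq
            (hκ.integrable_averaging h.integrable_sq) (hκ.sq_averaging_le h)
      _ = ∫ z, f z ^ 2 ∂μ := hκ.integral_averaging h.integrable_sq
      _ = ‖f‖ ^ 2 := by rw [← h.norm_toLp_sq, Lp.toLp_coeFn]

theorem averagingL2_apply (hκ : κ.Invariant μ) (f : Lp ℝ 2 μ) :
    averagingL2 hκ f = (hκ.memLp_averaging (Lp.memLp f)).toLp _ := rfl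

theorem norm_averagingL2_le (hκ : κ.Invariant μ) : ‖averagingL2 hκ‖ ≤ 1 :=
  LinearMap.mkContinuous_norm_le _ zero_le_one _

theorem averagingL2_toLp (hκ : κ.Invariant μ) {f : X → ℝ} (hf : MemLp f 2 μ) :
    averagingL2 hκ (hf.toLp f) = (hκ.memLp_averaging hf).toLp _ :=
  (MemLp.toLp_eq_toLp_iff (hκ.memLp_averaging (Lp.memLp _)) _).2
    (hκ.averaging_congr hf.coeFn_toLp)

theorem averagingL2_iterate_toLp (hκ : κ.Invariant μ) {f : X → ℝ} (hf : MemLp f 2 μ) (n : ℕ) :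
    (averagingL2 hκ)^[n] (hf.toLp f) = (hκ.memLp_iterate hf n).toLp _ := by
  induction n with
  | zero => rfl
  | succ n ih =>
    rw [Function.iterate_succ_apply', ih, averagingL2_toLp]
    simp only [Function.iterate_succ_apply']

/-- The mean ergodic theorem for an ergodic invariant kernel. -/
theorem Invariant.tendsto_cesaro_of_ergodic (hκ : κ.Invariant μ)
    (herg : ∀ B, MeasurableSet B → (∀ᵐ z ∂μ, z ∈ B → κ z Bᶜ = 0) → μ B = 0 ∨ μ B = 1)
    {φ ψ : X → ℝ} (hφ : MemLp φ 2 μ) (hψ : MemLp ψ 2 μ) :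
    Tendsto (fun n : ℕ => 1 / (n : ℝ) *
        ∑ j ∈ Finset.range n, ∫ z, κ.averaging^[j] φ z * ψ z ∂μ) atTop
      (𝓝 ((∫ z, φ z ∂μ) * ∫ z, ψ z ∂μ)) := by
  set P := averagingL2 hκ
  set K := P.eqLocus (1 : Lp ℝ 2 μ →L[ℝ] Lp ℝ 2 μ)
  set x := hφ.toLp φ
  set y : Lp ℝ 2 μ := ((K.orthogonalProjectionOnto x : K) : Lp ℝ 2 μ)
  have h1 := P.tendsto_birkhoffAverage_orthogonalProjection (norm_averagingL2_le hκ) x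
  have h2 := h1.inner (tendsto_const_nhds (x := hψ.toLp ψ)) (𝕜 := ℝ)
  have hyfix : κ.averaging y =ᵐ[μ] y := by
    have : P y = y := (K.orthogonalProjectionOnto x).2
    rw [averagingL2_apply] at this
    filter_upwards [(hκ.memLp_averaging (Lp.memLp y)).coeFn_toLp] with z hz
    rw [← hz, this]
  have hyc := hκ.ae_eq_const_of_averaging_eq herg (Lp.stronglyMeasurable y).measurable
    ((Lp.memLp y).integrable one_le_two) hyfix
  have hone : MemLp (fun _ : X => (1 : ℝ)) 2 μ := memLp_const 1
  have hK1 : hone.toLp _ ∈ K := by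
    change P (hone.toLp _) = hone.toLp _
    rw [averagingL2_toLp]
    exact (MemLp.toLp_eq_toLp_iff _ _).2 (ae_of_all _ fun z => by simp [averaging])
  -- Constants are fixed and `x - y` is orthogonal to the fixed space, so projecting preserves the
  -- mean.
  have hint : ∫ z, y z ∂μ = ∫ z, φ z ∂μ := by
    have h3 : inner ℝ (x - y) (hone.toLp _) = 0 :=
      Submodule.inner_left_of_mem_orthogonal hK1 (K.sub_starProjection_mem_orthogonal x)
    rw [inner_sub_left, sub_eq_zero, hφ.inner_toLp hone, ← Lp.toLp_coeFn y (Lp.memLp y),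
      (Lp.memLp y).inner_toLp hone] at h3
    simpa using h3.symm
  have hlim : inner ℝ y (hψ.toLp ψ) = (∫ z, φ z ∂μ) * ∫ z, ψ z ∂μ := by
    rw [← Lp.toLp_coeFn y (Lp.memLp y), (Lp.memLp y).inner_toLp hψ, ← integral_const_mul, ← hint]
    refine integral_congr_ae ?_
    filter_upwards [hyc] with z hz
    rw [← hz]
  rw [← hlim]
  refine h2.congr fun n => ?_
  simp only [birkhoffAverage, birkhoffSum, id]
  rw [real_inner_smul_left, sum_inner, one_div]
  congr 1
  refine Finset.sum_congr rfl fun j _ => ?_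
  rw [averagingL2_iterate_toLp hκ hφ, MemLp.inner_toLp]

/-- Convergence of correlations passes from square integrable to integrable weights if the
observable is bounded. -/
theorem tendsto_cesaro_of_bounded {φ : X → ℝ} {M : ℝ} (hM : ∀ z, |φ z| ≤ M)
    (hφ : ∀ n, AEStronglyMeasurable (κ.averaging^[n] φ) μ)
    (h : ∀ ψ : X → ℝ, MemLp ψ 2 μ → Tendsto (fun n : ℕ => 1 / (n : ℝ) *
        ∑ j ∈ Finset.range n, ∫ z, κ.averaging^[j] φ z * ψ z ∂μ) atTop
      (𝓝 ((∫ z, φ z ∂μ) * ∫ z, ψ z ∂μ)))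
    {ψ : X → ℝ} (hψ : Integrable ψ μ) :
    Tendsto (fun n : ℕ => 1 / (n : ℝ) *
        ∑ j ∈ Finset.range n, ∫ z, κ.averaging^[j] φ z * ψ z ∂μ) atTop
      (𝓝 ((∫ z, φ z ∂μ) * ∫ z, ψ z ∂μ)) := by
  refine tendsto_cesaro_of_approx fun ε hε => ?_
  set δ := ε / (|M| + 1) with hδ
  have hδ0 : 0 < δ := by positivity
  have hMδ : |M| * δ ≤ ε := by
    rw [hδ, mul_div_assoc', div_le_iff₀ (by positivity)]
    nlinarith [abs_nonneg M]
  obtain ⟨g, hg, -⟩ := (memLp_one_iff_integrable.2 hψ).exists_simpleFunc_eLpNorm_sub_lt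
    ENNReal.one_ne_top (ε := ENNReal.ofReal δ) (by simpa using hδ0)
  have hg2 : MemLp g 2 μ := g.memLp_of_isFiniteMeasure 2 μ
  have hgi : Integrable g μ := hg2.integrable one_le_two
  have hdist : ∫ z, |ψ z - g z| ∂μ ≤ δ := by
    have hl := hg.le
    rw [eLpNorm_one_eq_lintegral_enorm] at hl
    have := integral_norm_eq_lintegral_enorm (hψ.sub hgi).aestronglyMeasurable
    simp only [Pi.sub_apply, Real.norm_eq_abs] at this hl
    rw [this]
    exact ENNReal.toReal_le_of_le_ofReal hδ0.le hl
  have hbd : ∀ u : X → ℝ, AEStronglyMeasurable u μ → (∀ z, |u z| ≤ M) →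
      |∫ z, u z * ψ z ∂μ - ∫ z, u z * g z ∂μ| ≤ ε := by
    intro u hu huM
    have hb : ∀ᵐ z ∂μ, ‖u z‖ ≤ M := ae_of_all _ huM
    rw [← integral_sub (hψ.bdd_mul hu hb) (hgi.bdd_mul hu hb)]
    calc |∫ z, u z * ψ z - u z * g z ∂μ| ≤ ∫ z, |u z * ψ z - u z * g z| ∂μ :=
          abs_integral_le_integral_abs
      _ ≤ ∫ z, |M| * |ψ z - g z| ∂μ := by
          refine integral_mono ((hψ.bdd_mul hu hb).sub (hgi.bdd_mul hu hb)).abs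
            ((hψ.sub hgi).abs.const_mul _) fun z => ?_
          simp only [← mul_sub, abs_mul]
          exact mul_le_mul_of_nonneg_right ((huM z).trans (le_abs_self M)) (abs_nonneg _)
      _ = |M| * ∫ z, |ψ z - g z| ∂μ := integral_const_mul _ _
      _ ≤ |M| * δ := by gcongr
      _ ≤ ε := hMδ
  refine ⟨_, _, fun j => hbd _ (hφ j) (abs_iterate_averaging_le hM j), ?_, h g hg2⟩
  rw [abs_sub_comm, ← integral_const_mul, ← integral_const_mul]
  have hφM : |∫ z, φ z ∂μ| ≤ M := by
    have := norm_integral_le_of_norm_le_const (μ := μ) (f := φ) (C := M) (ae_of_all _ hM)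
    simpa using this
  -- The limits are compared by the same estimate, with the constant `∫ φ` in place of the iterate.
  exact hbd _ aestronglyMeasurable_const fun _ => hφM

/-- If the correlations of a family of observables that is dense in `L¹` converge, then the
kernel is ergodic. -/
theorem Invariant.measure_eq_zero_or_one (hκ : κ.Invariant μ) {B : Set X} (hB : MeasurableSet B)
    (hinv : ∀ᵐ z ∂μ, z ∈ B → κ z Bᶜ = 0)
    (h : ∀ ε > 0, ∃ φ : X → ℝ, Integrable φ μ ∧
      ∫ z, |B.indicator (fun _ => 1) z - φ z| ∂μ ≤ ε ∧
      Tendsto (fun n : ℕ => 1 / (n : ℝ) * ∑ j ∈ Finset.range n,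
        ∫ z, κ.averaging^[j] φ z * B.indicator (fun _ => 1) z ∂μ) atTop
        (𝓝 ((∫ z, φ z ∂μ) * ∫ z, B.indicator (fun _ => 1) z ∂μ))) :
    μ B = 0 ∨ μ B = 1 := by
  set χ : X → ℝ := B.indicator fun _ => 1 with hχ
  have hχi : Integrable χ μ := (integrable_const 1).indicator hB
  have hχB : ∫ z, χ z ∂μ = μ.real B := by simp [hχ, integral_indicator hB]
  have hχ1 : ∀ z, |χ z| ≤ 1 := fun z => by
    by_cases hz : z ∈ B <;> simp [hχ, hz]
  have hb : ∀ᵐ z ∂μ, ‖χ z‖ ≤ 1 := ae_of_all _ hχ1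
  have hfix : ∀ j, κ.averaging^[j] χ =ᵐ[μ] χ := by
    intro j
    induction j with
    | zero => rfl
    | succ j ih =>
      rw [Function.iterate_succ_apply']
      exact (hκ.averaging_congr ih).trans (hκ.averaging_indicator hB hinv)
  -- `μ(B)` is the correlation of `χ` with itself at every time, so the constant sequence is
  -- uniformly close to the correlations of `φ` with `χ`.
  have hlim : Tendsto (fun n : ℕ => 1 / (n : ℝ) * ∑ _j ∈ Finset.range n, μ.real B) atTop
      (𝓝 (μ.real B * μ.real B)) := by
    refine tendsto_cesaro_of_approx fun ε hε => ?_
    obtain ⟨φ, hφ, hε', ht⟩ := h ε hε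
    refine ⟨_, _, fun j => ?_, ?_, ht⟩
    · have hφj := hκ.integrable_iterate hφ j
      have h1 : μ.real B = ∫ z, χ z * χ z ∂μ := by
        rw [← hχB]
        refine integral_congr_ae (ae_of_all _ fun z => ?_)
        by_cases hz : z ∈ B <;> simp [hχ, hz]
      rw [h1, ← integral_sub (hχi.mul_bdd hχi.1 hb) (hφj.mul_bdd hχi.1 hb)]
      refine abs_integral_le_integral_abs.trans (le_trans ?_
        ((hκ.integral_abs_iterate_sub_le hχi hφ j).trans hε'))
      refine integral_mono_ae ((hχi.mul_bdd hχi.1 hb).sub (hφj.mul_bdd hχi.1 hb)).abs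
        ((hκ.integrable_iterate hχi j).sub hφj).abs ?_
      filter_upwards [hfix j] with z hz
      rw [hz, ← sub_mul, abs_mul]
      exact mul_le_of_le_one_right (abs_nonneg _) (hχ1 z)
    · rw [hχB, ← sub_mul, abs_mul, abs_of_nonneg (measureReal_nonneg (μ := μ) (s := B)), ← hχB,
        ← integral_sub hφ hχi, hχB]
      refine (mul_le_of_le_one_right (abs_nonneg _) measureReal_le_one).trans
        (abs_integral_le_integral_abs.trans (le_trans (le_of_eq ?_) hε'))
      exact integral_congr_ae (ae_of_all _ fun z => abs_sub_comm _ _)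
  have hconst : Tendsto (fun n : ℕ => 1 / (n : ℝ) * ∑ _j ∈ Finset.range n, μ.real B) atTop
      (𝓝 (μ.real B)) := by
    refine tendsto_const_nhds.congr' ?_
    filter_upwards [eventually_gt_atTop 0] with n hn
    have : (n : ℝ) ≠ 0 := by exact_mod_cast hn.ne'
    simp only [Finset.sum_const, Finset.card_range, nsmul_eq_mul]
    field_simp
  have heq := tendsto_nhds_unique hlim hconst
  by_cases h0 : μ.real B = 0
  · exact Or.inl ((measureReal_eq_zero_iff (measure_ne_top μ B)).1 h0)
  · have h1 : μ.real B = 1 := mul_eq_left₀ h0 |>.1 heq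
    refine Or.inr ?_
    rw [← ofReal_measureReal, h1, ENNReal.ofReal_one]

end ProbabilityTheory.Kernel

/-! ### Measurability of families of measures. -/

open scoped NNReal

/-- A family of probability measures is measurable if the integrals of bounded continuous
functions depend measurably on the parameter. -/
theorem MeasureTheory.measurable_of_measurable_integral {X Y : Type*} [TopologicalSpace X]
    [MeasurableSpace X] [BorelSpace X] [HasOuterApproxClosed X] [MeasurableSpace Y]
    {κ : Y → Measure X} [∀ y, IsProbabilityMeasure (κ y)]
    (h : ∀ φ : X → ℝ, Continuous φ → Measurable fun y => ∫ x, φ x ∂κ y) : Measurable κ := by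
  refine Measurable.measure_of_isPiSystem_of_isProbabilityMeasure
    (BorelSpace.measurable_eq.trans borel_eq_generateFrom_isClosed) isPiSystem_isClosed
    fun C hC => ?_
  -- Closed sets form a generating π-system, and their indicators are limits of continuous
  -- functions.
  refine measurable_of_tendsto_metrizable (f := fun n y => ∫⁻ x, hC.apprSeq n x ∂κ y)
    (fun n => ?_) (tendsto_pi_nhds.2 fun y => HasOuterApproxClosed.tendsto_lintegral_apprSeq hC (κ y))
  have hc : Continuous fun x => ((hC.apprSeq n x : ℝ≥0) : ℝ) :=
    NNReal.continuous_coe.comp (hC.apprSeq n).continuous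
  convert (h _ hc).ennreal_ofReal using 2 with y
  rw [lintegral_coe_eq_integral]
  refine Integrable.of_bound hc.aestronglyMeasurable 1 (ae_of_all _ fun x => ?_)
  simpa using HasOuterApproxClosed.apprSeq_apply_le_one hC n x

theorem MeasureTheory.exists_measurableSet_of_ae {X : Type*} [MeasurableSpace X] {μ : Measure X}
    {p : X → Prop} (h : ∀ᵐ z ∂μ, p z) :
    ∃ Z : Set X, (∀ z ∈ Z, p z) ∧ MeasurableSet Z ∧ ∀ᵐ z ∂μ, z ∈ Z := by
  refine ⟨(toMeasurable μ {z | ¬ p z})ᶜ, fun z hz => ?_,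
    (measurableSet_toMeasurable _ _).compl, ?_⟩
  · by_contra hp
    exact hz (subset_toMeasurable _ _ hp)
  · rw [ae_iff]
    simp only [mem_compl_iff, not_not, ofPred_mem_eq, measure_toMeasurable]
    exact h

/-! ### The Markov kernel of a correspondence. -/

namespace HolomorphicCorrespondence

open ProbabilityTheory

variable {k : ℕ} {X : Type*} [TopologicalSpace X] [ChartedSpace (EuclideanSpace ℂ (Fin k)) X]
  [MeasurableSpace X] (F : HolomorphicCorrespondence k X)

/-- The preimages of `z`, with their multiplicities divided by the topological degree. -/
noncomputable def fiberMeasure (z : X) : Measure X :=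
  ∑ j, ∑ w ∈ F.fiber j z,
    ENNReal.ofReal (1 / F.topologicalDegree * (F.m j * F.mult j w z)) • Measure.dirac w

theorem integral_fiberMeasure [MeasurableSingletonClass X] (φ : X → ℝ) (z : X) :
    ∫ w, φ w ∂F.fiberMeasure z = F.koopman φ z := by
  have hi : ∀ j, ∀ w ∈ F.fiber j z, Integrable φ
      (ENNReal.ofReal (1 / F.topologicalDegree * (F.m j * F.mult j w z)) • Measure.dirac w) :=
    fun j w _ => (integrable_dirac (by simp)).smul_measure ENNReal.ofReal_ne_top
  rw [fiberMeasure, integral_finsetSum_measure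
    fun j _ => integrable_finsetSum_measure.2 (hi j), koopman, preimageSum_eq, Finset.mul_sum]
  refine Finset.sum_congr rfl fun j _ => ?_
  rw [integral_finsetSum_measure (hi j), Finset.mul_sum, Finset.mul_sum]
  refine Finset.sum_congr rfl fun w _ => ?_
  rw [integral_smul_measure, integral_dirac, ENNReal.toReal_ofReal (by positivity), smul_eq_mul]
  ring

theorem fiberMeasure_apply_eq_zero {z : X} {s : Set X} (hs : MeasurableSet s)
    (h : ∀ j w, (w, z) ∈ F.Γ j → w ∉ s) : F.fiberMeasure z s = 0 := by
  simp only [fiberMeasure, Measure.coe_finsetSum, Finset.sum_apply, Measure.smul_apply,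
    Measure.dirac_apply' _ hs]
  refine Finset.sum_eq_zero fun j _ => Finset.sum_eq_zero fun w hw => ?_
  simp [h j w (mem_fiber.1 hw)]

theorem fiberMeasure_univ [Nonempty X] [CompactSpace X] [T2Space X] {z : X}
    (hz : F.preimageCount z = F.topologicalDegree) : F.fiberMeasure z univ = 1 := by
  have hd : (F.topologicalDegree : ℝ) ≠ 0 := by exact_mod_cast F.topologicalDegree_pos.ne'
  simp only [fiberMeasure, Measure.coe_finsetSum, Finset.sum_apply, Measure.smul_apply,
    measure_univ, smul_eq_mul, mul_one]
  have h1 : ∀ j ∈ Finset.univ, ∑ w ∈ F.fiber j z,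
      ENNReal.ofReal (1 / F.topologicalDegree * (F.m j * F.mult j w z)) = ENNReal.ofReal
        (∑ w ∈ F.fiber j z, 1 / (F.topologicalDegree : ℝ) * (F.m j * F.mult j w z)) :=
    fun j _ => (ENNReal.ofReal_sum_of_nonneg fun w _ => by positivity).symm
  rw [Finset.sum_congr rfl h1, ← ENNReal.ofReal_sum_of_nonneg fun j _ =>
    Finset.sum_nonneg fun w _ => by positivity]
  simp only [← Finset.mul_sum]
  rw [preimageCount] at hz
  have hz' : ∑ j, (F.m j : ℝ) * ∑ w ∈ F.fiber j z, (F.mult j w z : ℝ) = F.topologicalDegree := by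
    exact_mod_cast hz
  rw [hz', one_div, inv_mul_cancel₀ hd, ENNReal.ofReal_one]

/-- Every preimage carries positive mass, since its multiplicity is at least one. This turns a null
transition probability into a genuine inclusion of `F†`. -/
theorem mem_of_fiberMeasure_eq_zero [Nonempty X] [CompactSpace X] [T2Space X] {z w : X}
    {s : Set X} (hs : MeasurableSet s) (h : F.fiberMeasure z s = 0) {j : Fin F.N}
    (hw : (w, z) ∈ F.Γ j) : w ∉ s := by
  intro hws
  simp only [fiberMeasure, Measure.coe_finsetSum, Finset.sum_apply, Measure.smul_apply,
    Measure.dirac_apply' _ hs] at h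
  have h1 := Finset.sum_eq_zero_iff.1 (Finset.sum_eq_zero_iff.1 h j (Finset.mem_univ j)) w
    (mem_fiber.2 hw)
  have hd : (0 : ℝ) < F.topologicalDegree := by exact_mod_cast F.topologicalDegree_pos
  have hm : (0 : ℝ) < F.m j := by exact_mod_cast F.m_pos j
  have hn : (0 : ℝ) < F.mult j w z := by exact_mod_cast F.one_le_mult hw
  simp only [hws, indicator_of_mem, Pi.one_apply, smul_eq_mul, mul_one,
    ENNReal.ofReal_eq_zero] at h1
  exact absurd h1 (not_le.2 (by positivity))

variable {F} {μ : Measure X}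

/-- The count is at least `d` everywhere, while invariance on the constant `1` makes its mean equal
to `d`. -/
theorem IsInvariant.ae_preimageCount_eq [Nonempty X] [CompactSpace X] [T2Space X]
    [IsProbabilityMeasure μ] (hμ : F.IsInvariant μ) :
    ∀ᵐ z ∂μ, F.preimageCount z = F.topologicalDegree := by
  have hd := F.topologicalDegree_pos
  have h1 : ∫ z, (F.preimageCount z : ℝ) ∂μ = F.topologicalDegree := by
    have := hμ 1
    simpa [pullback, Pi.one_def, preimageSum_one] using this
  have hint : Integrable (fun z => (F.preimageCount z : ℝ)) μ := by
    -- A nonintegrable function has Bochner integral `0`, which contradicts `d > 0`; measurability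
    -- of the count thus comes for free.
    by_contra h
    rw [integral_undef h] at h1
    exact hd.ne (by exact_mod_cast h1)
  have h2 := (integral_eq_iff_of_ae_le (integrable_const (F.topologicalDegree : ℝ)) hint
    (ae_of_all _ fun z => Nat.cast_le.2 (F.topologicalDegree_le_preimageCount z))).1
    (by simp [h1])
  filter_upwards [h2] with z hz
  exact_mod_cast hz.symm

variable [T2Space X] {κ : Kernel X X}

/-- Almost invariance of a Borel set means that almost surely there are no transitions to the
complement. -/
theorem isAlmostInvariant_iff [Nonempty X] [CompactSpace X] [IsFiniteMeasure μ]
    (h : ∀ᵐ z ∂μ, κ z = F.fiberMeasure z) (B : Set X) :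
    F.IsAlmostInvariant μ B ↔ MeasurableSet B ∧ ∀ᵐ z ∂μ, z ∈ B → κ z Bᶜ = 0 := by
  constructor
  · rintro ⟨hB, B', hB', hsub, hmeas, hpre⟩
    refine ⟨hB, ?_⟩
    have hae : B' =ᵐ[μ] B :=
      ae_eq_of_subset_of_measure_ge hsub hmeas.le hB'.nullMeasurableSet (measure_ne_top _ _)
    filter_upwards [h, hae.mem_iff] with z hz hzB hzB'
    rw [hz]
    refine F.fiberMeasure_apply_eq_zero hB.compl fun j w hw hwB => hwB (hpre ?_)
    exact ⟨(w, z), ⟨hzB.2 hzB', mem_iUnion.2 ⟨j, hw⟩⟩, rfl⟩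
  · rintro ⟨hB, hinv⟩
    obtain ⟨Z, hZ, hZm, hZμ⟩ := exists_measurableSet_of_ae h
    -- Discarding a null set from `B` leaves points whose transitions are the true fibre and never
    -- leave `B`.
    refine ⟨hB, B ∩ Z ∩ {z | κ z Bᶜ = 0}, (hB.inter hZm).inter
      (κ.measurable_coe hB.compl (measurableSet_singleton 0)), fun z hz => hz.1.1, ?_, ?_⟩
    · refine measure_congr ?_
      filter_upwards [hinv, hZμ] with z h1 h2
      exact propext ⟨fun hz => ⟨⟨hz, h2⟩, h1 hz⟩, fun hz => hz.1.1⟩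
    · rintro w ⟨⟨w, z⟩, ⟨⟨⟨-, hzZ⟩, hz0⟩, hw⟩, rfl⟩
      obtain ⟨j, hj⟩ := mem_iUnion.1 hw
      have h0 : F.fiberMeasure z Bᶜ = 0 := hZ z hzZ ▸ hz0
      exact not_not.1 (F.mem_of_fiberMeasure_eq_zero hB.compl h0 hj)

variable [BorelSpace X]

/-- The preimages of a generic point with respect to an invariant measure form a Markov kernel, for
which the measure is invariant. -/
theorem IsInvariant.exists_kernel [Nonempty X] [CompactSpace X] [HasOuterApproxClosed X]
    [IsProbabilityMeasure μ] (hμ : F.IsInvariant μ) :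
    ∃ κ : Kernel X X, IsMarkovKernel κ ∧ κ.Invariant μ ∧ ∀ᵐ z ∂μ, κ z = F.fiberMeasure z := by
  classical
  obtain ⟨Z, hZ, hZm, hZμ⟩ := exists_measurableSet_of_ae hμ.ae_preimageCount_eq
  -- Off the full-measure set `Z` the count may exceed `d`; a Dirac mass there keeps the kernel
  -- Markov and measurable without affecting it almost everywhere.
  set κ : X → Measure X := fun z => if z ∈ Z then F.fiberMeasure z else Measure.dirac z with hκ
  have hκZ : ∀ z ∈ Z, κ z = F.fiberMeasure z := fun z hz => if_pos hz
  have hprob : ∀ z, IsProbabilityMeasure (κ z) := by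
    intro z
    by_cases hz : z ∈ Z
    · rw [hκZ z hz]
      exact ⟨F.fiberMeasure_univ (hZ z hz)⟩
    · simp only [hκ, if_neg hz]
      infer_instance
  have hmeas : Measurable κ := by
    refine measurable_of_measurable_integral fun φ hφ => ?_
    refine measurable_of_restrict_of_restrict_compl hZm ?_ ?_
    · have hc : ContinuousOn (F.koopman φ) Z :=
        ((F.continuousOn_preimageSum hφ).mono hZ).const_mul _
      have heq : Z.domRestrict (fun z => ∫ x, φ x ∂κ z) = Z.domRestrict (F.koopman φ) :=
        funext fun z => by simp [Set.domRestrict, hκZ z z.2, integral_fiberMeasure]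
      rw [heq]
      exact (continuousOn_iff_continuous_domRestrict.1 hc).measurable
    · have heq : Zᶜ.domRestrict (fun z => ∫ x, φ x ∂κ z) = Zᶜ.domRestrict φ :=
        funext fun z => by
          have hz : (z : X) ∉ Z := z.2
          simp [Set.domRestrict, hκ, hz]
      rw [heq]
      exact hφ.measurable.comp measurable_subtype_coe
  set K : Kernel X X := ⟨κ, hmeas⟩
  have hK : IsMarkovKernel K := ⟨hprob⟩
  refine ⟨K, hK, ?_, hZμ.mono hκZ⟩
  refine ext_of_forall_integral_eq_of_IsFiniteMeasure fun f => ?_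
  have hf : Integrable f ((K ∘ₖ Kernel.const Unit μ) ()) := f.integrable _
  have h1 := Kernel.integral_comp hf
  rw [← Measure.comp_eq_comp_const_apply, Kernel.const_apply] at h1
  rw [h1]
  have h2 : ∀ᵐ z ∂μ, ∫ w, f w ∂K z = 1 / F.topologicalDegree * F.preimageSum f z := by
    filter_upwards [hZμ] with z hz
    exact (congrArg (fun ν => ∫ w, f w ∂ν) (hκZ z hz)).trans (F.integral_fiberMeasure f z)
  have h3 := hμ f.toContinuousMap
  have hd : (F.topologicalDegree : ℝ) ≠ 0 := by exact_mod_cast F.topologicalDegree_pos.ne'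
  rw [integral_congr_ae h2, integral_const_mul]
  rw [pullback] at h3
  change ∫ z, F.preimageSum f z ∂μ = _ at h3
  rw [h3, one_div, inv_mul_cancel_left₀ hd]
  rfl

theorem koopman_iterate_ae_eq (hκ : κ.Invariant μ) (h : ∀ᵐ z ∂μ, κ z = F.fiberMeasure z)
    (φ : X → ℝ) (n : ℕ) : F.koopman^[n] φ =ᵐ[μ] κ.averaging^[n] φ := by
  have key : ∀ ψ : X → ℝ, F.koopman ψ =ᵐ[μ] κ.averaging ψ := fun ψ => by
    filter_upwards [h] with z hz
    rw [← integral_fiberMeasure, ← hz]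
    rfl
  induction n with
  | zero => rfl
  | succ n ih =>
    rw [Function.iterate_succ_apply', Function.iterate_succ_apply']
    exact (key _).trans (hκ.averaging_congr ih)

theorem correlation_eq (hκ : κ.Invariant μ) (h : ∀ᵐ z ∂μ, κ z = F.fiberMeasure z) (n : ℕ)
    (φ ψ : X → ℝ) : F.correlation μ n φ ψ = ∫ z, κ.averaging^[n] φ z * ψ z ∂μ := by
  refine integral_congr_ae ?_
  filter_upwards [koopman_iterate_ae_eq hκ h φ n] with z hz
  rw [hz]

end HolomorphicCorrespondence

/-! ### The equivalence. -/

theorem theorem4 {k : ℕ} {X : Type*} [TopologicalSpace X] [T2Space X] [CompactSpace X]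
    [ConnectedSpace X] [ChartedSpace (EuclideanSpace ℂ (Fin k)) X]
    [IsManifold 𝓘(ℂ, EuclideanSpace ℂ (Fin k)) ω X] [MeasurableSpace X] [BorelSpace X]
    (F : HolomorphicCorrespondence k X) (μ : Measure X) [IsProbabilityMeasure μ]
    (hμ : F.IsInvariant μ) :
    List.TFAE [
      F.IsErgodic μ,
      ∀ φ ψ : X → ℝ, MemLp φ 2 μ → MemLp ψ 2 μ →
        Tendsto (fun n : ℕ => 1 / (n : ℝ) * ∑ j ∈ Finset.range n, F.correlation μ j φ ψ) atTop
          (𝓝 ((∫ z, φ z ∂μ) * ∫ z, ψ z ∂μ)),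
      ∀ (φ : C(X, ℝ)) (ψ : X → ℝ), MemLp ψ 1 μ →
        Tendsto (fun n : ℕ => 1 / (n : ℝ) * ∑ j ∈ Finset.range n, F.correlation μ j φ ψ) atTop
          (𝓝 ((∫ z, φ z ∂μ) * ∫ z, ψ z ∂μ))] := by
  -- A compact Hausdorff manifold is metrizable, which supplies the approximation of closed sets and
  -- of `L¹` functions by continuous functions.
  have : SecondCountableTopology X :=
    ChartedSpace.secondCountable_of_sigmaCompact (EuclideanSpace ℂ (Fin k)) X
  have : TopologicalSpace.MetrizableSpace X :=
    TopologicalSpace.metrizableSpace_of_t3_secondCountable X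
  obtain ⟨κ, hM, hκ, hκF⟩ := hμ.exists_kernel
  simp only [HolomorphicCorrespondence.correlation_eq hκ hκF]
  tfae_have 1 → 2 := fun herg φ ψ hφ hψ => hκ.tendsto_cesaro_of_ergodic (fun B hB hinv =>
    herg B ((HolomorphicCorrespondence.isAlmostInvariant_iff hκF B).2 ⟨hB, hinv⟩)) hφ hψ
  tfae_have 2 → 3 := by
    intro h φ ψ hψ
    have hφM : ∀ z, |φ z| ≤ ‖φ‖ := φ.norm_coe_le_norm
    have hφ2 : MemLp φ 2 μ :=
      MemLp.of_bound φ.continuous.aestronglyMeasurable ‖φ‖ (ae_of_all _ hφM)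
    exact ProbabilityTheory.Kernel.tendsto_cesaro_of_bounded hφM
      (fun n => (hκ.memLp_iterate hφ2 n).aestronglyMeasurable) (fun ψ hψ => h φ ψ hφ2 hψ)
      (memLp_one_iff_integrable.1 hψ)
  tfae_have 3 → 1 := by
    intro h B hB
    obtain ⟨hBm, hinv⟩ := (HolomorphicCorrespondence.isAlmostInvariant_iff hκF B).1 hB
    have hχ : MemLp (B.indicator fun _ => (1 : ℝ)) 1 μ := (memLp_const 1).indicator hBm
    refine hκ.measure_eq_zero_or_one hBm hinv fun ε hε => ?_
    obtain ⟨φ, hφ, hφi⟩ := hχ.exists_boundedContinuous_eLpNorm_sub_le ENNReal.one_ne_top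
      (ε := ENNReal.ofReal ε) (by simpa using hε)
    rw [memLp_one_iff_integrable] at hφi
    refine ⟨φ, hφi, ?_, h φ.toContinuousMap _ hχ⟩
    rw [eLpNorm_one_eq_lintegral_enorm] at hφ
    have hnorm := integral_norm_eq_lintegral_enorm
      ((memLp_one_iff_integrable.1 hχ).sub hφi).aestronglyMeasurable
    simp only [Pi.sub_apply, Real.norm_eq_abs] at hnorm hφ
    rw [hnorm]
    exact ENNReal.toReal_le_of_le_ofReal hε.le hφ
  tfae_finish
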